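/- For an infinite word $s=s(0)s(1)s(2)\cdots$ over $\{0,1\}$ write $\sigma(s)=s(1)s(2)\cdots$ and let $\overline{\mathcal O}(s)$ be the closure of $\{\sigma^n(s):n\ge 0\}$ in the product topology. The word $s$ is Sturmian if for every $n\ge 0$ it has exactly $n+1$ factors of length $n$; its slope is the limit, as $n\to\infty$, of the proportion of letters $1$ in its prefix of length $n$. For an irrational $\alpha\in(0,1)$ put $s_{\alpha,0}(n)=\lfloor\alpha(n+1)\rfloor-\lfloor\alpha n\rfloor$ and $s'_{\alpha,0}(n)=\lceil\alpha(n+1)\rceil-\lceil\alpha n\rceil$ for $n\ge0$; the characteristic word $c_\alpha$ is defined by $s_{\alpha,0}=0c_\alpha$. For a real number $\beta>1$ let $T_\beta(x)=\beta x \bmod 1$ on $[0,1]$, let $d_\beta(x)=(\lfloor\beta T_\beta^{\,n}(x)\rfloor)_{n\ge0}$ be the $\beta$-expansion of $x\in[0,1]$, and let the $\beta$-shift $S_\beta$ be the closure of $\{d_\beta(x):x\in[0,1)\}$ in the product topology. Let $s$ be a Sturmian word over $\{0,1\}$ of slope $\alpha$. Among all the sets $S_\gamma$, $\gamma>1$,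 that contain $\overline{\mathcal O}(s)$ there is a smallest one with respect to inclusion. If $\beta>1$ is such that $S_\beta$ is this smallest set, then 1. $d_\beta(1)=1c_\alpha$; 2. $\overline{\{\sigma^n(d_\beta(1)):n\ge0\}}=\overline{\mathcal O}(s)$; 3. $\beta$ is the unique positive real solution $x$ of $$1=\sum_{n=0}^{\infty}\frac{s'_{\alpha,0}(n)}{x^{n+1}}.$$ -/

import Mathlib

open Filter Topology

namespace SturmianBeta

/-- Infinite words with integer letters, indexed from `0`. The topology is the product topology of
the discrete topology on `ℤ`, which induces the usual one on `A^ℕ` for each finite alphabet `A`. -/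
abbrev Word : Type := ℕ → ℤ

/-- The shift map `σ`. -/
def shift (s : Word) : Word := fun n => s (n + 1)

/-- The word `a s`, i.e. the letter `a` followed by `s`. -/
def cons (a : ℤ) (s : Word) : Word
  | 0 => a
  | n + 1 => s n

/-- The set `F_n(s)` of factors of length `n`. -/
def factors (s : Word) (n : ℕ) : Set (Fin n → ℤ) :=
  Set.range fun k : ℕ => fun i : Fin n => s (k + i)

/-- Sturmian words over `{0, 1}`: there are exactly `n + 1` factors of each length `n`. -/
def IsSturmian (s : Word) : Prop :=
  (∀ n, s n = 0 ∨ s n = 1) ∧ ∀ n, (factors s n).ncard = n + 1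

/-- The height of the prefix of length `n`: the number of occurrences of the letter `1`. -/
def prefixHeight (s : Word) (n : ℕ) : ℕ :=
  ((Finset.range n).filter fun i => s i = 1).card

/-- `s` has slope `α`: the slopes of the prefixes of `s` converge to `α`. -/
def HasSlope (s : Word) (α : ℝ) : Prop :=
  Tendsto (fun n : ℕ => (prefixHeight s n : ℝ) / n) atTop (𝓝 α)

/-- The lower mechanical word `s_{α,ρ}`. -/
noncomputable def lowerMechanical (α ρ : ℝ) : Word :=
  fun n => ⌊α * ((n : ℝ) + 1) + ρ⌋ - ⌊α * (n : ℝ) + ρ⌋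

/-- The upper mechanical word `s'_{α,ρ}`. -/
noncomputable def upperMechanical (α ρ : ℝ) : Word :=
  fun n => ⌈α * ((n : ℝ) + 1) + ρ⌉ - ⌈α * (n : ℝ) + ρ⌉

/-- The characteristic word `c_α`: the word `s_{α,0}` without its first letter. -/
noncomputable def characteristicWord (α : ℝ) : Word := shift (lowerMechanical α 0)

/-- The closure of `{σ^n(s) : n ≥ 0}`, i.e. the shift space generated by `s`. -/
def orbitClosure (s : Word) : Set Word :=
  closure (Set.range fun n : ℕ => shift^[n] s)

/-- The `β`-transformation `x ↦ β x mod 1`. -/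
noncomputable def betaMap (β x : ℝ) : ℝ := Int.fract (β * x)

/-- The `β`-expansion `d_β(x)`; the letter with index `n` is `⌊β T_β^n(x)⌋`. -/
noncomputable def betaExpansion (β x : ℝ) : Word := fun n => ⌊β * (betaMap β)^[n] x⌋

/-- The `β`-shift `S_β`: the closure of the set of `β`-expansions of the points of `[0, 1)`. -/
noncomputable def betaShift (β : ℝ) : Set Word :=
  closure (betaExpansion β '' Set.Ico 0 1)

/-- `S_β` is the smallest (for inclusion) among all `β`-shifts that contain `X`. -/
def IsSmallestBetaShift (β : ℝ) (X : Set Word) : Prop :=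
  1 < β ∧ IsLeast {S : Set Word | (∃ γ : ℝ, 1 < γ ∧ S = betaShift γ) ∧ X ⊆ S} (betaShift β)

end SturmianBeta

namespace SturmianBeta

/-! The key is balance: in a Sturmian word, factors of equal length have heights differing by at
most 1 (`IsSturmian.height_le`). So a factor of length `n` has height within 1 of `α n`, and `α` is
irrational. The word `u = upperMechanical α 0`, which equals `1 c_α`, has prefix heights `⌈α n⌉`,
the largest that this allows, and it lies in the orbit closure of `s`.

By subadditivity of the ceiling, prefixes of `u` are at least as high as all factors of `u` of the
same length. Choose `β > 1` such that `u` has value 1 in base `β`. Abel summation turns the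
comparison of heights into one of values: every proper suffix of `u` has value in `[0, 1)`. This
forces `u = d_β(1)` and makes the proper suffixes `β`-expansions of points of `[0, 1)`. Conversely,
if `S_γ` contains `u`, then `u` has value at most 1 in base `γ`, so `β ≤ γ`. Since `S_γ` grows
strictly with `γ`, `S_β` is the smallest and determines `β`. Minimality, a consequence of
Morse–Hedlund, identifies the orbit closures of `u` and of its shift with that of `s`. Comparing
heights takes the place of Parry's lexicographic criterion. -/

/-! ### Factors, periodicity and right special factors -/

/-- The factor of length `n` of `s` that starts at position `k`. -/
def window (s : Word) (n k : ℕ) : Fin n → ℤ := fun i => s (k + i)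

/-- The sum of the letters of the factor of length `n` that starts at position `k`. -/
def height (s : Word) (k n : ℕ) : ℤ := ∑ i ∈ Finset.range n, s (k + i)

/-- `s` is ultimately periodic. -/
def EventuallyPeriodic (s : Word) : Prop :=
  ∃ N p : ℕ, 0 < p ∧ ∀ n, N ≤ n → s (n + p) = s n

theorem window_eq_iff {s t : Word} {n k l : ℕ} :
    window s n k = window t n l ↔ ∀ i < n, s (k + i) = t (l + i) := by
  constructor
  · intro h i hi
    exact congrFun h ⟨i, hi⟩
  · intro h
    funext i
    exact h i i.2

theorem window_mem_factors (s : Word) (n k : ℕ) : window s n k ∈ factors s n := ⟨k, rfl⟩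

theorem window_shift_eq {s : Word} {n a b : ℕ} (h : window s n a = window s n b)
    (h' : s (a + n) = s (b + n)) : window s n (a + 1) = window s n (b + 1) := by
  rw [window_eq_iff] at h ⊢
  intro i hi
  rcases Nat.lt_or_ge (i + 1) n with h1 | h1
  · have := h (i + 1) h1
    rwa [show a + 1 + i = a + (i + 1) by omega, show b + 1 + i = b + (i + 1) by omega]
  · rwa [show a + 1 + i = a + n by omega, show b + 1 + i = b + n by omega]

theorem window_succ_eq_iff {s : Word} {n a b : ℕ} :
    window s (n + 1) a = window s (n + 1) b ↔
      window s n a = window s n b ∧ s (a + n) = s (b + n) := by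
  simp only [window_eq_iff]
  constructor
  · intro h
    exact ⟨fun i hi => h i (by omega), h n (by omega)⟩
  · rintro ⟨h, h'⟩ i hi
    rcases Nat.lt_succ_iff_lt_or_eq.1 hi with h1 | rfl
    · exact h i h1
    · exact h'

/-- If a factor recurs and the next letter is forced throughout the cycle, the word is ultimately
periodic. -/
theorem eventuallyPeriodic_of_deterministic {s : Word} {n i j : ℕ} (hij : i < j)
    (hw : window s n i = window s n j)
    (hdet : ∀ a, i ≤ a → a < j → ∀ b, window s n a = window s n b → s (a + n) = s (b + n)) :
    EventuallyPeriodic s := by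
  -- The windows at `i + t` and `j + t` stay equal and always repeat one from the cycle `[i, j)`, so
  -- `hdet` keeps applying.
  have key : ∀ t, window s n (i + t) = window s n (j + t) ∧
      ∃ a, i ≤ a ∧ a < j ∧ window s n a = window s n (i + t) := by
    intro t
    induction t with
    | zero => exact ⟨hw, i, le_rfl, hij, rfl⟩
    | succ t ih =>
      obtain ⟨h1, a, ha, haj, h2⟩ := ih
      have e1 := hdet a ha haj _ h2
      have e2 := hdet a ha haj _ (h2.trans h1)
      refine ⟨window_shift_eq h1 (e1.symm.trans e2), ?_⟩
      have h3 := window_shift_eq h2 e1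
      rcases Nat.lt_or_ge (a + 1) j with h4 | h4
      · exact ⟨a + 1, by omega, h4, h3⟩
      · refine ⟨i, le_rfl, hij, ?_⟩
        rw [hw, show j = a + 1 by omega]
        exact h3
  refine ⟨i + n, j - i, by omega, fun m hm => ?_⟩
  obtain ⟨t, rfl⟩ : ∃ t, m = i + t + n := ⟨m - i - n, by omega⟩
  obtain ⟨h1, a, ha, haj, h2⟩ := key t
  rw [show i + t + n + (j - i) = j + t + n by omega, ← hdet a ha haj _ h2,
    hdet a ha haj _ (h2.trans h1)]

theorem ncard_factors_le_of_eventuallyPeriodic {s : Word} (h : EventuallyPeriodic s) :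
    ∃ C, ∀ n, (factors s n).ncard ≤ C := by
  obtain ⟨N, p, hp, h⟩ := h
  refine ⟨N + p, fun n => ?_⟩
  have hsub : factors s n ⊆ window s n '' (Finset.range (N + p) : Set ℕ) := by
    rintro _ ⟨k, rfl⟩
    change window s n k ∈ _
    induction k using Nat.strong_induction_on with
    | _ k ih =>
      rcases Nat.lt_or_ge k (N + p) with hk | hk
      · exact ⟨k, by simpa using hk, rfl⟩
      · have : window s n k = window s n (k - p) := by
          rw [window_eq_iff]
          intro i _
          rw [← h (k - p + i) (by omega), show k - p + i + p = k + i by omega]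
        rw [this]
        exact ih _ (by omega)
  calc (factors s n).ncard ≤ (window s n '' (Finset.range (N + p) : Set ℕ)).ncard :=
        Set.ncard_le_ncard hsub ((Finset.finite_toSet _).image _)
    _ ≤ (Finset.range (N + p) : Set ℕ).ncard := Set.ncard_image_le (Finset.finite_toSet _)
    _ = N + p := by rw [Set.ncard_coe_finset, Finset.card_range]

theorem image_init_factors (s : Word) (n : ℕ) :
    (fun f : Fin (n + 1) → ℤ => fun i : Fin n => f i.castSucc) '' factors s (n + 1) =
      factors s n := by
  ext f
  constructor
  · rintro ⟨_, ⟨k, rfl⟩, rfl⟩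
    exact ⟨k, rfl⟩
  · rintro ⟨k, rfl⟩
    exact ⟨_, ⟨k, rfl⟩, rfl⟩

/-- If the numbers of factors of lengths `n` and `n + 1` differ, some factor of length `n` can be
followed by two distinct letters. -/
theorem exists_right_special {s : Word} {n : ℕ}
    (h : (factors s n).ncard ≠ (factors s (n + 1)).ncard) :
    ∃ a b, window s n a = window s n b ∧ s (a + n) ≠ s (b + n) := by
  by_contra! hcon
  apply h
  rw [← image_init_factors s n]
  apply Set.InjOn.ncard_image
  rintro _ ⟨a, rfl⟩ _ ⟨b, rfl⟩ hab
  have hab' : window s n a = window s n b := hab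
  exact window_succ_eq_iff.2 ⟨hab', hcon a b hab'⟩

/-- A word with `n + 2` factors of length `n + 1` and `n + 1` factors of length `n` has at most one
right special factor of length `n`. -/
theorem right_special_unique {s : Word} {n : ℕ}
    (h : (factors s (n + 1)).ncard ≤ (factors s n).ncard + 1)
    (hfin : (factors s (n + 1)).Finite) {a b c d : ℕ}
    (hab : window s n a = window s n b) (hab' : s (a + n) ≠ s (b + n))
    (hcd : window s n c = window s n d) (hcd' : s (c + n) ≠ s (d + n)) :
    window s n a = window s n c := by
  by_contra hne
  set A := window s (n + 1) a
  set C := window s (n + 1) c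
  have hAC : A ≠ C := fun e => hne (window_succ_eq_iff.1 e).1
  -- The positions `b` and `d` supply other extensions of the two special factors, so removing `A`
  -- and `C` loses no factor of length `n`. The count then drops by at least 2 from length `n + 1`
  -- to `n`.
  have hsub : factors s n ⊆ (fun f : Fin (n + 1) → ℤ => fun i : Fin n => f i.castSucc) ''
      (factors s (n + 1) \ {A, C}) := by
    rintro _ ⟨k, rfl⟩
    by_cases hA : window s (n + 1) k = A
    · refine ⟨window s (n + 1) b, ⟨window_mem_factors _ _ _, ?_⟩, ?_⟩
      · rintro (e | e)
        · exact hab' (window_succ_eq_iff.1 e).2.symm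
        · exact hne (hab.trans (window_succ_eq_iff.1 e).1)
      · exact (hab.symm.trans (window_succ_eq_iff.1 hA).1.symm :)
    · by_cases hC : window s (n + 1) k = C
      · refine ⟨window s (n + 1) d, ⟨window_mem_factors _ _ _, ?_⟩, ?_⟩
        · rintro (e | e)
          · exact hne ((window_succ_eq_iff.1 e).1.symm.trans hcd.symm)
          · exact hcd' (window_succ_eq_iff.1 e).2.symm
        · exact (hcd.symm.trans (window_succ_eq_iff.1 hC).1.symm :)
      · exact ⟨window s (n + 1) k, ⟨window_mem_factors _ _ _, by simp [hA, hC]⟩, rfl⟩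
  have h1 := Set.ncard_le_ncard hsub ((hfin.sdiff).image _)
  have h2 := Set.ncard_image_le (f := fun f : Fin (n + 1) → ℤ => fun i : Fin n => f i.castSucc)
    (hfin.sdiff (t := {A, C}))
  have h3 : ({A, C} : Set _) ⊆ factors s (n + 1) := by
    rintro x (rfl | rfl) <;> exact window_mem_factors _ _ _
  have h4 := Set.ncard_sdiff_add_ncard_of_subset h3 hfin
  rw [Set.ncard_pair hAC] at h4
  omega

/-- The Morse–Hedlund theorem. -/
theorem succ_le_ncard_factors {s : Word} (hs : ¬ EventuallyPeriodic s)
    (hfin : ∀ n, (factors s n).Finite) (n : ℕ) : n + 1 ≤ (factors s n).ncard := by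
  induction n with
  | zero =>
    have := (Set.ncard_pos (hfin 0)).2 ⟨_, window_mem_factors s 0 0⟩
    omega
  | succ n ih =>
    have hle : (factors s n).ncard ≤ (factors s (n + 1)).ncard := by
      rw [← image_init_factors s n]
      exact Set.ncard_image_le (hfin _)
    have hne : (factors s n).ncard ≠ (factors s (n + 1)).ncard := by
      intro heq
      rw [← image_init_factors s n] at heq
      have hinj := Set.injOn_of_ncard_image_eq heq (hfin _)
      have := (hfin n).to_subtype
      obtain ⟨i, j, hij, hw⟩ := Finite.exists_ne_map_eq_of_infinite
        (fun k : ℕ => (⟨window s n k, window_mem_factors s n k⟩ : factors s n))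
      have hw' : window s n i = window s n j := congrArg Subtype.val hw
      have hdet : ∀ a b, window s n a = window s n b → s (a + n) = s (b + n) := fun a b hab =>
        (window_succ_eq_iff.1 (hinj (window_mem_factors s (n + 1) a)
          (window_mem_factors s (n + 1) b) hab)).2
      rcases Nat.lt_or_gt_of_ne hij with h | h
      · exact hs (eventuallyPeriodic_of_deterministic h hw' fun a _ _ => hdet a)
      · exact hs (eventuallyPeriodic_of_deterministic h hw'.symm fun a _ _ => hdet a)
    omega

/-! ### Balance of Sturmian words -/

theorem IsSturmian.finite_factors {s : Word} (hs : IsSturmian s) (n : ℕ) :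
    (factors s n).Finite :=
  Set.finite_of_ncard_pos (by rw [hs.2 n]; omega)

theorem IsSturmian.not_eventuallyPeriodic {s : Word} (hs : IsSturmian s) :
    ¬ EventuallyPeriodic s := by
  intro h
  obtain ⟨C, hC⟩ := ncard_factors_le_of_eventuallyPeriodic h
  have := hC C
  rw [hs.2] at this
  omega

theorem height_add (s : Word) (k m n : ℕ) :
    height s k (m + n) = height s k m + height s (k + m) n := by
  simp only [height, Finset.sum_range_add, add_assoc]

theorem height_one (s : Word) (k : ℕ) : height s k 1 = s k := by simp [height]

theorem height_zero (s : Word) (k : ℕ) : height s k 0 = 0 := by simp [height]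

/-- A palindromic factor `b w b` of a Sturmian word excludes that `a w`, with `a ≠ b`, is right
special. -/
theorem IsSturmian.not_special_of_palindrome {s : Word} (hs : IsSturmian s) {m p q c : ℕ}
    (hpal : ∀ i < m + 2, s (q + i) = s (q + (m + 1 - i)))
    (hne : s p ≠ s q) (heq : ∀ i < m, s (p + (i + 1)) = s (q + (i + 1)))
    (hsp : window s (m + 1) p = window s (m + 1) c) (hsp' : s (p + (m + 1)) ≠ s (c + (m + 1))) :
    False := by
  have hlast : s (q + (m + 1)) = s q := by simpa using (hpal 0 (by omega)).symm
  -- An occurrence of `a w` inside the cycle would read, at offset `m + 1 - j`, the last letter `b`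
  -- of the palindrome. By reflection that letter of `w` is also `s (q + j) = a`.
  have hno : ∀ j < m + 2, window s (m + 1) (q + j) ≠ window s (m + 1) p := by
    intro j hj h
    rw [window_eq_iff] at h
    have h0 : s (q + j) = s p := by simpa using h 0 (by omega)
    rcases Nat.eq_zero_or_pos j with rfl | hj0
    · exact hne h0.symm
    rcases Nat.lt_or_ge j (m + 1) with hj1 | hj1
    · have h1 := h (m + 1 - j) (by omega)
      rw [show q + j + (m + 1 - j) = q + (m + 1) by omega, hlast] at h1
      have h2 := heq (m - j) (by omega)
      rw [show m - j + 1 = m + 1 - j by omega, ← hpal j hj, ← h1, h0] at h2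
      exact hne h2.symm
    · rw [show j = m + 1 by omega, hlast] at h0
      exact hne h0.symm
  have hdet : ∀ a, q ≤ a → a < q + (m + 2) → ∀ b, window s (m + 1) a = window s (m + 1) b →
      s (a + (m + 1)) = s (b + (m + 1)) := by
    intro a ha ha' b hab
    by_contra hcon
    obtain ⟨j, rfl⟩ := Nat.exists_eq_add_of_le ha
    exact hno j (by omega) (right_special_unique (by rw [hs.2, hs.2]) (hs.finite_factors _)
      hab hcon hsp hsp')
  -- There are `m + 2` starting positions but only `m + 1` factors other than `a w`, so two windows
  -- coincide. Between them no window is right special, which forces periodicity.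
  have hmaps : Set.MapsTo (fun j => window s (m + 1) (q + j)) (Finset.range (m + 2) : Set ℕ)
      ((hs.finite_factors (m + 1)).toFinset.erase (window s (m + 1) p) : Set _) := by
    intro j hj
    simp only [Finset.coe_range, Set.mem_Iio] at hj
    simp only [Finset.coe_erase, Set.Finite.coe_toFinset]
    exact ⟨window_mem_factors _ _ _, hno j hj⟩
  have hcard : ((hs.finite_factors (m + 1)).toFinset.erase (window s (m + 1) p)).card <
      (Finset.range (m + 2)).card := by
    rw [Finset.card_erase_of_mem (by simpa using window_mem_factors _ _ _),
      ← Set.ncard_eq_toFinset_card _ (hs.finite_factors _), hs.2, Finset.card_range]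
    omega
  obtain ⟨i, hi, j, hj, hij, hw⟩ := Finset.exists_ne_map_eq_of_card_lt_of_maps_to hcard hmaps
  simp only [Finset.mem_range] at hi hj
  apply hs.not_eventuallyPeriodic
  rcases Nat.lt_or_gt_of_ne hij with h | h
  · exact eventuallyPeriodic_of_deterministic (show q + i < q + j by omega) hw
      fun a h1 h2 => hdet a (by omega) (by omega)
  · exact eventuallyPeriodic_of_deterministic (show q + j < q + i by omega) hw.symm
      fun a h1 h2 => hdet a (by omega) (by omega)

/-- Sturmian words are balanced. -/
theorem IsSturmian.height_le {s : Word} (hs : IsSturmian s) (n p q : ℕ) :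
    height s q n ≤ height s p n + 1 := by
  induction n using Nat.strong_induction_on generalizing p q with
  | _ n ih =>
  by_contra! hcon
  have h01 : ∀ k, 0 ≤ s k ∧ s k ≤ 1 := fun k => by rcases hs.1 k with h | h <;> simp [h]
  obtain ⟨m, rfl⟩ : ∃ m, n = m + 2 := by
    rcases n with _ | _ | m
    · simp [height_zero] at hcon
    · simp only [zero_add, height_one] at hcon
      have := h01 p; have := h01 q; omega
    · exact ⟨m, rfl⟩
  -- At a shortest violation the total excess is at least 2 and each of two complementary pieces
  -- contributes at most 1, hence exactly 1. So the two factors are `0w0` and `1w1`.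
  have hpre : ∀ l, 0 < l → l < m + 2 → height s q l = height s p l + 1 := by
    intro l h0 h1
    have e1 := height_add s p l (m + 2 - l)
    have e2 := height_add s q l (m + 2 - l)
    rw [show l + (m + 2 - l) = m + 2 by omega] at e1 e2
    have := ih l h1 p q
    have := ih (m + 2 - l) (by omega) (p + l) (q + l)
    omega
  have hsucc : ∀ k l, height s k (l + 1) = height s k l + s (k + l) := by
    intro k l; rw [height_add, height_one]
  have hp0 : s q = s p + 1 := by
    have := hpre 1 (by omega) (by omega)
    simpa [height_one] using this
  have hend : height s q (m + 2) = height s p (m + 2) + 2 ∧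
      s (q + (m + 1)) = s (p + (m + 1)) + 1 := by
    have h1 := hpre (m + 1) (by omega) (by omega)
    have h2 := hsucc p (m + 1)
    have h3 := hsucc q (m + 1)
    have := h01 (p + (m + 1)); have := h01 (q + (m + 1))
    rw [show m + 1 + 1 = m + 2 by omega] at h2 h3
    omega
  have hmid : ∀ i < m, s (p + (i + 1)) = s (q + (i + 1)) := by
    intro i hi
    have h1 := hpre (i + 1) (by omega) (by omega)
    have h2 := hpre (i + 1 + 1) (by omega) (by omega)
    rw [hsucc, hsucc p (i + 1)] at h2
    omega
  -- Comparing the prefix of each factor with the suffix of the other shows that prefixes and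
  -- suffixes of equal length have equal heights; hence both factors are palindromes.
  have hrev : ∀ l, 0 < l → l < m + 2 →
      height s p l = height s p (m + 2) - height s p (m + 2 - l) := by
    intro l h0 h1
    have e1 := height_add s p (m + 2 - l) l
    have e2 := height_add s q (m + 2 - l) l
    rw [show m + 2 - l + l = m + 2 by omega] at e1 e2
    have := hpre l h0 h1
    have := hpre (m + 2 - l) (by omega) (by omega)
    have := ih l h1 p (q + (m + 2 - l))
    have := ih l h1 (p + (m + 2 - l)) q
    omega
  have h0p := h01 p; have h0q := h01 q
  have h0p' := h01 (p + (m + 1)); have h0q' := h01 (q + (m + 1))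
  have hpalp : ∀ i < m + 2, s (p + i) = s (p + (m + 1 - i)) := by
    intro i hi
    rcases Nat.eq_zero_or_pos i with rfl | hi0
    · simp only [add_zero, Nat.sub_zero]; omega
    rcases Nat.lt_or_ge i (m + 1) with hi1 | hi1
    · have h1 := hrev i hi0 hi
      have h2 := hrev (i + 1) (by omega) (by omega)
      rw [show m + 2 - (i + 1) = m + 1 - i by omega, hsucc p i] at h2
      rw [show m + 2 - i = m + 1 - i + 1 by omega, hsucc p (m + 1 - i)] at h1
      omega
    · obtain rfl : i = m + 1 := by omega
      simp only [Nat.sub_self, add_zero]; omega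
  have hpalq : ∀ i < m + 2, s (q + i) = s (q + (m + 1 - i)) := by
    intro i hi
    rcases Nat.eq_zero_or_pos i with rfl | hi0
    · simp only [add_zero, Nat.sub_zero]; omega
    rcases Nat.lt_or_ge i (m + 1) with hi1 | hi1
    · have h1 := hmid (i - 1) (by omega)
      have h2 := hmid (m + 1 - i - 1) (by omega)
      rw [show i - 1 + 1 = i by omega] at h1
      rw [show m + 1 - i - 1 + 1 = m + 1 - i by omega] at h2
      rw [← h1, ← h2]
      exact hpalp i hi
    · obtain rfl : i = m + 1 := by omega
      simp only [Nat.sub_self, add_zero]; omega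
  -- The word `w` is followed by both letters, so it is the right special factor of length `m`. The
  -- one of length `m + 1` must end in it: it is `0w` or `1w`.
  obtain ⟨a, b, hab, hab'⟩ := exists_right_special (s := s) (n := m + 1) (by rw [hs.2, hs.2]; omega)
  have htail : ∀ {k l : ℕ}, window s (m + 1) k = window s (m + 1) l →
      window s m (k + 1) = window s m (l + 1) := by
    intro k l h
    rw [window_eq_iff] at h ⊢
    intro i hi
    simpa only [add_assoc, add_comm 1 i] using h (i + 1) (by omega)
  have hw : window s m (a + 1) = window s m (p + 1) := by
    refine right_special_unique (b := b + 1) (d := q + 1) (by rw [hs.2, hs.2])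
      (hs.finite_factors _) (htail hab) ?_ ?_ ?_
    · simpa only [add_assoc, add_comm 1 m] using hab'
    · rw [window_eq_iff]
      intro i hi
      simpa only [add_assoc, add_comm 1 i] using hmid i hi
    · rw [show p + 1 + m = p + (m + 1) by omega, show q + 1 + m = q + (m + 1) by omega]
      omega
  have hext : ∀ k, s a = s k → (∀ i < m, s (p + (i + 1)) = s (k + (i + 1))) →
      window s (m + 1) k = window s (m + 1) a := by
    intro k hk hk'
    rw [window_eq_iff] at hw ⊢
    intro i hi
    rcases i with _ | i
    · exact hk.symm
    · rw [← hk' i (by omega)]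
      simpa only [add_assoc, add_comm 1 i] using (hw i (by omega)).symm
  have hfin : ∀ k, window s (m + 1) k = window s (m + 1) a →
      ∃ c, window s (m + 1) k = window s (m + 1) c ∧ s (k + (m + 1)) ≠ s (c + (m + 1)) := by
    intro k hk
    by_cases h : s (k + (m + 1)) = s (a + (m + 1))
    · exact ⟨b, hk.trans hab, h ▸ hab'⟩
    · exact ⟨a, hk, h⟩
  have ha := h01 a
  -- Either choice is excluded by the palindrome built on the opposite letter.
  have hcase : s a = s p ∨ s a = s q := by omega
  rcases hcase with h | h
  · obtain ⟨c, hc, hc'⟩ := hfin p (hext p h fun _ _ => rfl)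
    exact hs.not_special_of_palindrome hpalq (by omega) hmid hc hc'
  · obtain ⟨c, hc, hc'⟩ := hfin q (hext q h hmid)
    exact hs.not_special_of_palindrome hpalp (by omega) (fun i hi => (hmid i hi).symm) hc hc'

/-! ### Orbit closures and minimality -/

theorem mem_closure_iff_prefix {A : Set Word} {x : Word} :
    x ∈ closure A ↔ ∀ n, ∃ y ∈ A, ∀ i < n, y i = x i := by
  rw [(PiNat.isTopologicalBasis_cylinders (fun _ : ℕ => ℤ)).mem_closure_iff]
  constructor
  · intro h n
    obtain ⟨y, hy, hyA⟩ := h (PiNat.cylinder x n) ⟨x, n, rfl⟩ (PiNat.self_mem_cylinder x n)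
    exact ⟨y, hyA, PiNat.mem_cylinder_iff.1 hy⟩
  · rintro h _ ⟨z, n, rfl⟩ hx
    obtain ⟨y, hyA, hy⟩ := h n
    refine ⟨y, ?_, hyA⟩
    rw [PiNat.mem_cylinder_iff] at hx ⊢
    intro i hi
    rw [hy i hi, hx i hi]

theorem iterate_shift_apply (s : Word) (n i : ℕ) : shift^[n] s i = s (n + i) := by
  induction n generalizing i with
  | zero => simp
  | succ n ih => rw [Function.iterate_succ_apply', shift, ih]; congr 1; omega

theorem mem_orbitClosure_iff {s t : Word} :
    t ∈ orbitClosure s ↔ ∀ n, window t n 0 ∈ factors s n := by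
  rw [orbitClosure, mem_closure_iff_prefix]
  refine forall_congr' fun n => ?_
  simp only [Set.exists_range_iff, iterate_shift_apply]
  refine exists_congr fun k => ?_
  change _ ↔ window s n k = window t n 0
  rw [window_eq_iff]
  simp only [zero_add]

theorem factors_subset_of_mem_orbitClosure {s t : Word} (h : t ∈ orbitClosure s) (n : ℕ) :
    factors t n ⊆ factors s n := by
  rintro _ ⟨k, rfl⟩
  obtain ⟨l, hl⟩ := mem_orbitClosure_iff.1 h (k + n)
  refine ⟨l + k, ?_⟩
  change window s (k + n) l = window t (k + n) 0 at hl
  change window s n (l + k) = window t n k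
  rw [window_eq_iff] at hl ⊢
  intro i hi
  simpa only [add_assoc, zero_add] using hl (k + i) (by omega)

theorem orbitClosure_congr {s t : Word} (h : ∀ n, factors t n = factors s n) :
    orbitClosure t = orbitClosure s := by
  ext x
  simp only [mem_orbitClosure_iff, h]

theorem shift_mem_orbitClosure {s t : Word} (h : t ∈ orbitClosure s) :
    shift t ∈ orbitClosure s := by
  rw [mem_orbitClosure_iff]
  intro n
  apply factors_subset_of_mem_orbitClosure h
  refine ⟨1, ?_⟩
  change window t n 1 = _
  rw [window_eq_iff]
  intro i _
  rw [shift]; congr 1; omega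

/-- Minimality of the shift space of a Sturmian word. -/
theorem IsSturmian.orbitClosure_eq {s t : Word} (hs : IsSturmian s) (h : t ∈ orbitClosure s)
    (ht : ¬ EventuallyPeriodic t) : orbitClosure t = orbitClosure s := by
  apply orbitClosure_congr
  intro n
  have hsub := factors_subset_of_mem_orbitClosure h
  -- The factors of `t` are among the `n + 1` factors of `s`, and Morse–Hedlund gives at least `n +
  -- 1` of them.
  refine Set.eq_of_subset_of_ncard_le (hsub n) ?_ (hs.finite_factors n)
  rw [hs.2]
  exact succ_le_ncard_factors ht (fun m => (hs.finite_factors m).subset (hsub m)) n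

/-! ### Heights and slope -/

theorem IsSturmian.prefixHeight_eq {s : Word} (hs : IsSturmian s) (n : ℕ) :
    (prefixHeight s n : ℤ) = height s 0 n := by
  rw [prefixHeight, height, Finset.card_filter]
  push_cast
  refine Finset.sum_congr rfl fun i _ => ?_
  rw [zero_add]
  rcases hs.1 i with h | h <;> simp [h]

/-- The prefix splits into `j` blocks of length `n`, and balance costs at most 1 per block. -/
theorem IsSturmian.abs_height_mul_sub_le {s : Word} (hs : IsSturmian s) (k n j : ℕ) :
    |height s 0 (j * n) - j * height s k n| ≤ j := by
  induction j with
  | zero => simp [height_zero]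
  | succ j ih =>
    rw [Nat.succ_mul, height_add]
    have h1 := hs.height_le n k (0 + j * n)
    have h2 := hs.height_le n (0 + j * n) k
    rw [abs_le] at ih ⊢
    push_cast
    constructor <;> linarith

/-- Every factor of length `n` of a Sturmian word of slope `α` has height within `1` of `α n`. -/
theorem IsSturmian.abs_height_sub_le {s : Word} {α : ℝ} (hs : IsSturmian s) (hα : HasSlope s α)
    (k n : ℕ) : |(height s k n : ℝ) - α * n| ≤ 1 := by
  rcases Nat.eq_zero_or_pos n with rfl | hn
  · simp [height_zero]
  have hn' : (0 : ℝ) < n := by exact_mod_cast hn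
  have hlim : Tendsto (fun j : ℕ => (height s 0 (j * n) : ℝ) / j) atTop (𝓝 (α * n)) := by
    have h1 : Tendsto (fun j : ℕ => j * n) atTop atTop :=
      tendsto_id.atTop_mul_const' hn
    have h2 := (hα.comp h1).mul_const (n : ℝ)
    refine h2.congr fun j => ?_
    rw [← hs.prefixHeight_eq]
    simp only [Function.comp]
    push_cast
    rcases Nat.eq_zero_or_pos j with rfl | hj
    · simp
    · have : (j : ℝ) ≠ 0 := by positivity
      field_simp
  have hclose : ∀ j : ℕ, 0 < j → |(height s k n : ℝ) - (height s 0 (j * n) : ℝ) / j| ≤ 1 := by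
    intro j hj
    have hj' : (0 : ℝ) < j := by exact_mod_cast hj
    have h : |(height s 0 (j * n) : ℝ) - j * height s k n| ≤ j := by
      exact_mod_cast hs.abs_height_mul_sub_le k n j
    rw [show (height s k n : ℝ) - (height s 0 (j * n) : ℝ) / j =
      -((height s 0 (j * n) : ℝ) - j * height s k n) / j by field_simp; ring, abs_div, abs_neg,
      abs_of_pos hj', div_le_one hj']
    exact h
  exact le_of_tendsto (tendsto_const_nhds.sub hlim).abs
    (eventually_atTop.2 ⟨1, fun j hj => hclose j hj⟩)

/-- A bounded sequence of integers that is nondecreasing along each residue class modulo `q` is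
ultimately `q`-periodic. -/
theorem exists_forall_add_eq_of_le {f : ℕ → ℤ} {q : ℕ} (hf : ∀ n, f n ≤ f (n + q))
    {C : ℤ} (hC : ∀ n, f n ≤ C) : ∃ N, ∀ n, N ≤ n → f (n + q) = f n := by
  -- A sliding sum over `q` terms increases by `f (n + q) - f n ≥ 0` at each step. Being bounded and
  -- integral it attains its maximum, after which every increment vanishes.
  set F : ℕ → ℤ := fun n => ∑ i ∈ Finset.range q, f (n + i)
  have hstep : ∀ n, F (n + 1) = F n + (f (n + q) - f n) := by
    intro n
    have h1 := Finset.sum_range_succ (fun i => f (n + i)) q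
    have h2 := Finset.sum_range_succ' (fun i => f (n + i)) q
    have h3 : ∀ i, f (n + 1 + i) = f (n + (i + 1)) := fun i => by congr 1; omega
    simp only [F, h3]
    simp only [add_zero] at h2
    linarith
  have hmono : Monotone F := monotone_nat_of_le_succ fun n => by
    rw [hstep]; have := hf n; linarith
  have hbd : ∀ n, F n ≤ q * C := fun n => by
    simpa [F] using Finset.sum_le_card_nsmul (Finset.range q) (fun i => f (n + i)) C
      fun i _ => hC _
  obtain ⟨_, ⟨N, rfl⟩, hN⟩ := Int.exists_greatest_of_bdd (P := fun z => ∃ n, F n = z)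
    ⟨q * C, by rintro _ ⟨n, rfl⟩; exact hbd n⟩ ⟨F 0, 0, rfl⟩
  refine ⟨N, fun n hn => ?_⟩
  have h1 := hmono hn
  have h2 := hN _ ⟨n + 1, rfl⟩
  have h3 := hf n
  rw [hstep] at h2
  linarith

/-- Sliding a window of length `q` by one place drops `s n` and gains `s (n + q)`. -/
theorem eventuallyPeriodic_of_height_eq {s : Word} {q N : ℕ} {c : ℤ} (hq : 0 < q)
    (h : ∀ n, N ≤ n → height s n q = c) : EventuallyPeriodic s := by
  refine ⟨N, q, hq, fun n hn => ?_⟩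
  have h1 := height_add s n q 1
  have h2 := height_add s n 1 q
  rw [h n hn, height_one] at h1
  rw [h (n + 1) (by omega), height_one, add_comm 1 q] at h2
  linarith

/-- The slope of a Sturmian word is irrational. -/
theorem IsSturmian.irrational_slope {s : Word} {α : ℝ} (hs : IsSturmian s) (hα : HasSlope s α) :
    Irrational α := by
  rintro ⟨r, rfl⟩
  apply hs.not_eventuallyPeriodic
  have hq : 0 < r.den := r.den_pos
  have hbd : ∀ n : ℕ, |(r.den : ℤ) * height s 0 n - r.num * n| ≤ r.den := by
    intro n
    have h := hs.abs_height_sub_le hα 0 n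
    have hq' : (0 : ℝ) < r.den := by exact_mod_cast hq
    have hr : (r : ℝ) * r.den = r.num := by exact_mod_cast r.mul_den_eq_num
    have h2 : |(r.den : ℝ) * height s 0 n - r.num * n| ≤ r.den := by
      rw [← hr, show (r.den : ℝ) * height s 0 n - r * r.den * n =
        r.den * ((height s 0 n : ℝ) - r * n) by ring, abs_mul, abs_of_pos hq']
      exact mul_le_of_le_one_right hq'.le h
    exact_mod_cast h2
  have hstep : ∀ n : ℕ, (r.den : ℤ) * height s 0 (n + r.den) - r.num * ((n + r.den : ℕ) : ℤ) =
      (r.den : ℤ) * height s 0 n - r.num * n + r.den * (height s n r.den - r.num) := by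
    intro n
    rw [height_add, zero_add]
    push_cast
    ring
  have hq' : (0 : ℤ) < r.den := by exact_mod_cast hq
  have hconcl : ∀ N, (∀ n : ℕ, N ≤ n → (r.den : ℤ) * (height s n r.den - r.num) = 0) →
      EventuallyPeriodic s := fun N hN =>
    eventuallyPeriodic_of_height_eq (c := r.num) hq fun n hn => by
      rcases mul_eq_zero.1 (hN n hn) with h | h
      · exact absurd h hq'.ne'
      · linarith
  -- By balance, the heights of the factors of length `r.den` all lie on one side of `r.num`. So the
  -- bounded sequence `r.den * height s 0 n - r.num * n` is monotone along residue classes, up to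
  -- sign.
  by_cases hlow : ∀ n, r.num ≤ height s n r.den
  · obtain ⟨N, hN⟩ := exists_forall_add_eq_of_le
      (f := fun n => (r.den : ℤ) * height s 0 n - r.num * n) (q := r.den) (C := r.den)
      (fun n => by
        rw [hstep]
        have := mul_nonneg hq'.le (sub_nonneg.2 (hlow n))
        linarith) (fun n => (abs_le.1 (hbd n)).2)
    refine hconcl N fun n hn => ?_
    have := hN n hn
    simp only [hstep] at this
    linarith
  · push Not at hlow
    obtain ⟨k, hk⟩ := hlow
    have hup : ∀ n, height s n r.den ≤ r.num := fun n => by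
      have := hs.height_le r.den k n
      linarith
    obtain ⟨N, hN⟩ := exists_forall_add_eq_of_le
      (f := fun n => -((r.den : ℤ) * height s 0 n - r.num * n)) (q := r.den) (C := r.den)
      (fun n => by
        rw [hstep]
        have := mul_nonneg hq'.le (sub_nonneg.2 (hup n))
        linarith) (fun n => by have := (abs_le.1 (hbd n)).1; linarith)
    refine hconcl N fun n hn => ?_
    have := hN n hn
    simp only [hstep] at this
    linarith

theorem IsSturmian.slope_mem_Ioo {s : Word} {α : ℝ} (hs : IsSturmian s) (hα : HasSlope s α) :
    α ∈ Set.Ioo (0 : ℝ) 1 := by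
  have hirr := hs.irrational_slope hα
  have h0 : 0 ≤ α := ge_of_tendsto' hα fun n => by positivity
  have h1 : α ≤ 1 := le_of_tendsto' hα fun n => by
    refine div_le_one_of_le₀ ?_ (by positivity)
    exact_mod_cast (Finset.card_filter_le _ _).trans_eq (Finset.card_range n)
  exact ⟨h0.lt_of_ne' hirr.ne_zero, h1.lt_of_ne hirr.ne_one⟩

/-! ### The upper mechanical word -/

theorem height_upperMechanical (α : ℝ) (k n : ℕ) :
    height (upperMechanical α 0) k n = ⌈α * ((k + n : ℕ) : ℝ)⌉ - ⌈α * (k : ℝ)⌉ := by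
  induction n with
  | zero => simp [height_zero]
  | succ n ih =>
    rw [height_add, ih, height_one, upperMechanical]
    push_cast
    simp only [add_zero, add_assoc]
    ring

/-- The height of a factor is less than that of the prefix of the same length, unless the slope is
rational. -/
theorem exists_height_upperMechanical_lt {α : ℝ} (hα : Irrational α) {m : ℕ} (hm : 0 < m) :
    ∃ n, height (upperMechanical α 0) m n < height (upperMechanical α 0) 0 n := by
  by_contra! hcon
  simp only [height_upperMechanical, Nat.cast_zero, mul_zero, Int.ceil_zero, sub_zero,
    zero_add] at hcon
  -- Otherwise `⌈α k m⌉` would grow at least like `k ⌈α m⌉`, outpacing `α k m + 1` because `α m` is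
  -- not an integer.
  have hlow : ∀ k : ℕ, (k : ℤ) * ⌈α * (m : ℝ)⌉ ≤ ⌈α * ((k * m : ℕ) : ℝ)⌉ := by
    intro k
    induction k with
    | zero => simp
    | succ k ih =>
      have := hcon (k * m)
      rw [show (k + 1) * m = m + k * m by ring]
      push_cast at this ih ⊢
      linarith
  have hlt : α * m < ⌈α * (m : ℝ)⌉ := (Int.le_ceil _).lt_of_ne ((hα.mul_natCast hm.ne').ne_int _)
  obtain ⟨k, hk⟩ := exists_nat_gt (1 / ((⌈α * (m : ℝ)⌉ : ℝ) - α * m))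
  rw [div_lt_iff₀ (by linarith)] at hk
  have h1 : (k : ℝ) * (⌈α * (m : ℝ)⌉ : ℝ) ≤ (⌈α * ((k * m : ℕ) : ℝ)⌉ : ℝ) := by
    exact_mod_cast hlow k
  have h2 := Int.ceil_lt_add_one (α * ((k * m : ℕ) : ℝ))
  push_cast at h1 h2
  nlinarith

/-- This is subadditivity of the ceiling. -/
theorem height_upperMechanical_le (α : ℝ) (m n : ℕ) :
    height (upperMechanical α 0) m n ≤ height (upperMechanical α 0) 0 n := by
  simp only [height_upperMechanical, Nat.cast_zero, mul_zero, Int.ceil_zero, sub_zero, zero_add]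
  have := Int.ceil_add_le (α * m) (α * n)
  push_cast
  rw [mul_add]
  linarith

theorem not_eventuallyPeriodic_shift {s : Word} (hs : ¬ EventuallyPeriodic s) :
    ¬ EventuallyPeriodic (shift s) := by
  rintro ⟨N, p, hp, h⟩
  refine hs ⟨N + 1, p, hp, fun n hn => ?_⟩
  have := h (n - 1) (by omega)
  simp only [shift] at this
  rwa [show n - 1 + p + 1 = n + p by omega, show n - 1 + 1 = n by omega] at this

/-- The height `k c` of `k` periods stays within 1 of `α k p` for all `k`, which would give `c = α
p`. -/
theorem not_eventuallyPeriodic_upperMechanical {α : ℝ} (hα : Irrational α) :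
    ¬ EventuallyPeriodic (upperMechanical α 0) := by
  rintro ⟨N, p, hp, h⟩
  set c := height (upperMechanical α 0) N p
  have hc : ∀ k : ℕ, height (upperMechanical α 0) N (k * p) = k * c := by
    have hper : ∀ k i : ℕ, upperMechanical α 0 (N + k * p + i) = upperMechanical α 0 (N + i) := by
      intro k i
      induction k with
      | zero => simp
      | succ k ih => rw [← ih, ← h (N + k * p + i) (by lia)]; congr 1; ring
    intro k
    induction k with
    | zero => simp [height_zero]
    | succ k ih =>
      rw [Nat.succ_mul, height_add, ih]
      have : height (upperMechanical α 0) (N + k * p) p = c := by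
        simp only [c, height, hper]
      rw [this]; push_cast; ring
  have hbd : ∀ k : ℕ, k * |(c : ℝ) - α * p| ≤ 1 := by
    intro k
    have h1 : (⌈α * ((N + k * p : ℕ) : ℝ)⌉ : ℝ) - ⌈α * (N : ℝ)⌉ = k * c := by
      have := (height_upperMechanical α N (k * p)).symm.trans (hc k)
      exact_mod_cast this
    have h2 := Int.ceil_lt_add_one (α * ((N + k * p : ℕ) : ℝ))
    have h3 := Int.le_ceil (α * ((N + k * p : ℕ) : ℝ))
    have h4 := Int.ceil_lt_add_one (α * (N : ℝ))
    have h5 := Int.le_ceil (α * (N : ℝ))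
    push_cast at h1 h2 h3
    have h6 : (k : ℝ) * |(c : ℝ) - α * p| = |k * ((c : ℝ) - α * p)| := by
      rw [abs_mul, Nat.abs_cast]
    rw [h6, abs_le]
    constructor <;> linarith
  have hne : (0 : ℝ) < |(c : ℝ) - α * p| := by
    rw [abs_pos, sub_ne_zero]
    exact ((hα.mul_natCast hp.ne').ne_int c).symm
  obtain ⟨k, hk⟩ := exists_nat_gt (1 / |(c : ℝ) - α * p|)
  rw [div_lt_iff₀ hne] at hk
  exact absurd (hbd k) (not_le.2 hk)

/-- The upper mechanical word of intercept `0` lies in every Sturmian shift of the same slope. -/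
theorem IsSturmian.upperMechanical_mem_orbitClosure {s : Word} {α : ℝ} (hs : IsSturmian s)
    (hα : HasSlope s α) : upperMechanical α 0 ∈ orbitClosure s := by
  rw [mem_orbitClosure_iff]
  intro n
  have hirr := hs.irrational_slope hα
  -- Here `ε` is a common lower bound for the distances from `α i` down to `⌈α i⌉ - 1`, `i ≤ n`.
  obtain ⟨ε, hε, hεn⟩ : ∃ ε > 0, ∀ i ∈ Finset.range (n + 1),
      ε ≤ α * (i : ℝ) - ((⌈α * (i : ℝ)⌉ : ℝ) - 1) := by
    generalize Finset.range (n + 1) = S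
    induction S using Finset.induction_on with
    | empty => exact ⟨1, one_pos, by simp⟩
    | insert i S _ ih =>
      obtain ⟨ε, hε, h⟩ := ih
      have h2 := Int.ceil_lt_add_one (α * (i : ℝ))
      refine ⟨min ε (α * (i : ℝ) - ((⌈α * (i : ℝ)⌉ : ℝ) - 1)), lt_min hε (by linarith), ?_⟩
      intro j hj
      rcases Finset.mem_insert.1 hj with rfl | hj
      · exact min_le_right _ _
      · exact (min_le_left _ _).trans (h j hj)
  set D : ℕ → ℝ := fun k => (height s 0 k : ℝ) - α * k
  have hbdd : BddBelow (Set.range D) :=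
    ⟨-1, by rintro _ ⟨k, rfl⟩; exact (abs_le.1 (hs.abs_height_sub_le hα 0 k)).1⟩
  -- Where the discrepancy `D` is nearly minimal it can drop by less than `ε` afterwards. Hence
  -- heights from `k` exceed `⌈α i⌉ - 1`, while balance keeps them below `⌈α i⌉ + 1`.
  obtain ⟨k, hk⟩ := exists_lt_of_ciInf_lt (lt_add_of_pos_right (iInf D) hε)
  have hheight : ∀ i < n + 1, height s k i = ⌈α * (i : ℝ)⌉ := by
    intro i hi
    rcases Nat.eq_zero_or_pos i with rfl | hi0
    · simp [height_zero]
    have h1 := hk.trans_le (add_le_add_left (ciInf_le hbdd (k + i)) ε)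
    have h2 := hεn i (Finset.mem_range.2 hi)
    have h3 := (abs_le.1 (hs.abs_height_sub_le hα k i)).2
    have h4 : α * (i : ℝ) < ⌈α * (i : ℝ)⌉ :=
      (Int.le_ceil _).lt_of_ne ((hirr.mul_natCast hi0.ne').ne_int _)
    simp only [D, height_add, zero_add] at h1 hk
    push_cast at h1
    have h5 : (⌈α * (i : ℝ)⌉ : ℝ) - 1 < height s k i := by linarith
    have h6 : (height s k i : ℝ) < ⌈α * (i : ℝ)⌉ + 1 := by linarith
    have h5' : ⌈α * (i : ℝ)⌉ - 1 < height s k i := by exact_mod_cast h5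
    have h6' : height s k i < ⌈α * (i : ℝ)⌉ + 1 := by exact_mod_cast h6
    omega
  refine ⟨k, ?_⟩
  change window s n k = _
  rw [window_eq_iff]
  intro i hi
  have h1 := height_add s k i 1
  rw [height_one, hheight i (by omega), hheight (i + 1) (by omega)] at h1
  rw [upperMechanical]
  push_cast at h1
  simp only [zero_add, add_zero]
  linarith

/-! ### `β`-expansions and `β`-shifts -/

/-- The value `∑ w(i) / γ^(i+1)`, `i < n`, of a prefix of `w` in base `γ`. -/
noncomputable def prefixValue (γ : ℝ) (w : Word) (n : ℕ) : ℝ :=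
  ∑ i ∈ Finset.range n, (w i : ℝ) / γ ^ (i + 1)

theorem betaMap_iterate_mem {β x : ℝ} (hx : x ∈ Set.Ico (0 : ℝ) 1) (n : ℕ) :
    (betaMap β)^[n] x ∈ Set.Ico (0 : ℝ) 1 := by
  cases n with
  | zero => exact hx
  | succ n =>
    rw [Function.iterate_succ_apply']
    exact ⟨Int.fract_nonneg _, Int.fract_lt_one _⟩

theorem betaExpansion_nonneg {β x : ℝ} (hβ : 1 < β) (hx : x ∈ Set.Ico (0 : ℝ) 1) (n : ℕ) :
    0 ≤ betaExpansion β x n :=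
  Int.floor_nonneg.2 (mul_nonneg (by linarith) (betaMap_iterate_mem hx n).1)

theorem prefixValue_betaExpansion {β x : ℝ} (hβ : 1 < β) (n : ℕ) :
    prefixValue β (betaExpansion β x) n = x - (betaMap β)^[n] x / β ^ n := by
  have hβ0 : β ≠ 0 := by linarith
  induction n with
  | zero => simp [prefixValue]
  | succ n ih =>
    rw [prefixValue, Finset.sum_range_succ, ← prefixValue, ih, Function.iterate_succ_apply',
      betaExpansion, betaMap, Int.fract]
    field_simp
    ring

theorem hasSum_betaExpansion {β x : ℝ} (hβ : 1 < β) (hx : x ∈ Set.Ico (0 : ℝ) 1) :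
    HasSum (fun n => (betaExpansion β x n : ℝ) / β ^ (n + 1)) x := by
  have hβ0 : 0 < β := by linarith
  rw [hasSum_iff_tendsto_nat_of_nonneg fun n => div_nonneg
    (by exact_mod_cast betaExpansion_nonneg hβ hx n) (by positivity)]
  have h1 : Tendsto (fun n : ℕ => (betaMap β)^[n] x / β ^ n) atTop (𝓝 0) := by
    refine squeeze_zero (g := fun n => β⁻¹ ^ n)
      (fun n => div_nonneg (betaMap_iterate_mem hx n).1 (by positivity)) (fun n => ?_)
      (tendsto_pow_atTop_nhds_zero_of_lt_one (by positivity) (inv_lt_one_of_one_lt₀ hβ))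
    rw [inv_pow, ← one_div]
    exact div_le_div_of_nonneg_right (betaMap_iterate_mem hx n).2.le (by positivity)
  have h2 := (tendsto_const_nhds (x := x)).sub h1
  rw [sub_zero] at h2
  exact h2.congr fun n => (prefixValue_betaExpansion hβ n).symm

theorem shift_iterate_betaExpansion (β x : ℝ) (n : ℕ) :
    shift^[n] (betaExpansion β x) = betaExpansion β ((betaMap β)^[n] x) := by
  funext i
  rw [iterate_shift_apply, betaExpansion, betaExpansion, ← Function.iterate_add_apply, add_comm]

/-- A word is the `β`-expansion of its value if all its proper suffixes have values in `[0, 1)`. -/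
theorem betaExpansion_eq {β : ℝ} (hβ : 1 < β) {w : Word} {y : ℕ → ℝ}
    (hy : ∀ n, HasSum (fun i => (w (n + i) : ℝ) / β ^ (i + 1)) (y n))
    (hy0 : ∀ n, 0 ≤ y (n + 1)) (hy1 : ∀ n, y (n + 1) < 1) : betaExpansion β (y 0) = w := by
  have hβ0 : β ≠ 0 := by linarith
  -- With `y (n + 1)` in `[0, 1)`, this splits `β * y n` into floor and fractional part. Nothing is
  -- asked of `y 0`, so the expansion of 1 is covered.
  have hrec : ∀ n, β * y n = w n + y (n + 1) := by
    intro n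
    have h1 := (hy (n + 1)).div_const β
    have h2 := (hasSum_nat_add_iff' 1).2 (hy n)
    simp only [Finset.sum_range_one, add_zero, zero_add, pow_one] at h2
    have h3 : y (n + 1) / β = y n - w n / β := by
      refine h1.unique (h2.congr_fun ?_)
      intro i
      rw [show n + 1 + i = n + (i + 1) by omega, pow_succ β (i + 1), div_div]
    field_simp at h3
    linarith
  have hiter : ∀ n, (betaMap β)^[n] (y 0) = y n := by
    intro n
    induction n with
    | zero => rfl
    | succ n ih =>
      rw [Function.iterate_succ_apply', ih, betaMap, hrec, Int.fract_intCast_add,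
        Int.fract_eq_self.2 ⟨hy0 n, hy1 n⟩]
  funext n
  rw [betaExpansion, hiter, hrec, Int.floor_intCast_add, Int.floor_eq_zero_iff.2 ⟨hy0 n, hy1 n⟩,
    add_zero]

/-- Both conditions hold for expansions and involve finitely many letters at a time, so they survive
the closure. -/
theorem mem_betaShift_bounds {γ : ℝ} (hγ : 1 < γ) {w : Word} (hw : w ∈ betaShift γ) :
    (∀ n, 0 ≤ w n) ∧ ∀ n, prefixValue γ w n ≤ 1 := by
  rw [betaShift, mem_closure_iff_prefix] at hw
  constructor
  · intro n
    obtain ⟨_, ⟨x, hx, rfl⟩, h⟩ := hw (n + 1)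
    rw [← h n (by omega)]
    exact betaExpansion_nonneg hγ hx n
  · intro n
    obtain ⟨_, ⟨x, hx, rfl⟩, h⟩ := hw n
    have h1 : prefixValue γ w n = prefixValue γ (betaExpansion γ x) n :=
      Finset.sum_congr rfl fun i hi => by rw [h i (Finset.mem_range.1 hi)]
    rw [h1, prefixValue_betaExpansion hγ]
    have := div_nonneg (betaMap_iterate_mem (β := γ) hx n).1 (by positivity : 0 ≤ γ ^ n)
    have := hx.2
    linarith

theorem div_pow_le_div_pow {a b : ℝ} (ha : 0 < a) (hab : a ≤ b) {z : ℤ} (hz : 0 ≤ z) (n : ℕ) :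
    (z : ℝ) / b ^ n ≤ z / a ^ n := by
  have : (0 : ℝ) ≤ z := by exact_mod_cast hz
  gcongr

theorem hasSum_div_pow_lt {w : Word} (hw : ∀ n, 0 ≤ w n) (hw0 : 0 < w 0) {a b u v : ℝ}
    (ha : 0 < a) (hab : a < b) (hu : HasSum (fun n => (w n : ℝ) / a ^ (n + 1)) u)
    (hv : HasSum (fun n => (w n : ℝ) / b ^ (n + 1)) v) : v < u := by
  refine hasSum_lt (i := 0) (fun n => div_pow_le_div_pow ha hab.le (hw n) _) ?_ hv hu
  have : (0 : ℝ) < w 0 := by exact_mod_cast hw0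
  simp only [zero_add, pow_one]
  gcongr

/-- Read in the larger base, the suffixes of a `β`-expansion have values no larger than before,
still in `[0, 1)`; so the same word is a `γ`-expansion. -/
theorem betaShift_mono {β γ : ℝ} (hβ : 1 < β) (hβγ : β ≤ γ) : betaShift β ⊆ betaShift γ := by
  have hβ0 : 0 < β := by linarith
  apply closure_mono
  rintro _ ⟨x, hx, rfl⟩
  have hsuff : ∀ n, ∃ y, HasSum (fun i => (betaExpansion β x (n + i) : ℝ) / γ ^ (i + 1)) y ∧
      0 ≤ y ∧ y < 1 := by
    intro n
    have hxn := betaMap_iterate_mem (β := β) hx n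
    have hle := fun i => div_pow_le_div_pow hβ0 hβγ (betaExpansion_nonneg hβ hxn i) (i + 1)
    have hnn : ∀ i, (0 : ℝ) ≤ (betaExpansion β ((betaMap β)^[n] x) i : ℝ) / γ ^ (i + 1) :=
      fun i => div_nonneg (by exact_mod_cast betaExpansion_nonneg hβ hxn i)
        (pow_nonneg (hβ0.le.trans hβγ) _)
    have hs := hasSum_betaExpansion hβ hxn
    have hs' := (Summable.of_nonneg_of_le hnn hle hs.summable).hasSum
    refine ⟨_, ?_, hs'.nonneg hnn, (hasSum_le hle hs' hs).trans_lt hxn.2⟩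
    simpa only [← shift_iterate_betaExpansion, iterate_shift_apply] using hs'
  choose y hy hy0 hy1 using hsuff
  exact ⟨y 0, ⟨hy0 0, hy1 0⟩, betaExpansion_eq (hβ.trans_le hβγ) hy (fun n => hy0 _)
    fun n => hy1 _⟩

/-- If `β < γ`, a word with value at most 1 in base `β` has value at most `β / γ` in base `γ`. The
`γ`-expansion of a point of `(β / γ, 1)` is therefore not in `S_β`. -/
theorem le_of_betaShift_subset {β γ : ℝ} (hβ : 1 < β) (h : betaShift γ ⊆ betaShift β) :
    γ ≤ β := by
  by_contra! hlt
  have hβ0 : 0 < β := by linarith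
  have hγ0 : 0 < γ := by linarith
  obtain ⟨x, hx1, hx2⟩ := exists_between ((div_lt_one hγ0).2 hlt)
  have hx : x ∈ Set.Ico (0 : ℝ) 1 := ⟨(div_pos hβ0 hγ0).le.trans hx1.le, hx2⟩
  have hγ : 1 < γ := hβ.trans hlt
  have hmem := mem_betaShift_bounds hβ (h (subset_closure ⟨x, hx, rfl⟩))
  have hle : ∀ n, prefixValue γ (betaExpansion γ x) n ≤ β / γ := by
    intro n
    refine le_trans ?_ (mul_le_of_le_one_right (div_pos hβ0 hγ0).le (hmem.2 n))
    rw [prefixValue, prefixValue, Finset.mul_sum]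
    refine Finset.sum_le_sum fun i _ => ?_
    have := div_pow_le_div_pow hβ0 hlt.le (hmem.1 i) i
    rw [pow_succ, pow_succ, ← div_div, ← div_div,
      show β / γ * ((betaExpansion γ x i : ℝ) / β ^ i / β) =
        (betaExpansion γ x i : ℝ) / β ^ i / γ by field_simp]
    gcongr
  have hlim := (hasSum_betaExpansion hγ hx).tendsto_sum_nat
  exact absurd (le_of_tendsto' hlim hle) (not_le.2 hx1)

/-! ### The base in which the upper mechanical word has value 1 -/

/-- Abel summation. -/
theorem sum_mul_pow_eq (c : ℕ → ℝ) (r : ℝ) (n : ℕ) :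
    ∑ i ∈ Finset.range n, c i * r ^ (i + 1) =
      (1 - r) * ∑ j ∈ Finset.range n, (∑ i ∈ Finset.range (j + 1), c i) * r ^ (j + 1) +
      (∑ i ∈ Finset.range n, c i) * r ^ (n + 1) := by
  induction n with
  | zero => simp
  | succ n ih =>
    rw [Finset.sum_range_succ, ih, Finset.sum_range_succ _ n, Finset.sum_range_succ c n]
    ring

/-- A series whose coefficients have nonnegative partial sums, not all zero, is positive at each
point of `(0, 1)`. -/
theorem hasSum_mul_pow_pos {c : ℕ → ℝ} {r v : ℝ} (hr0 : 0 < r) (hr1 : r < 1)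
    (hc : ∀ n, 0 ≤ ∑ i ∈ Finset.range n, c i) {N : ℕ} (hN : 0 < ∑ i ∈ Finset.range N, c i)
    (hv : HasSum (fun i => c i * r ^ (i + 1)) v) : 0 < v := by
  obtain ⟨N, rfl⟩ : ∃ k, N = k + 1 :=
    Nat.exists_eq_succ_of_ne_zero (by rintro rfl; simp at hN)
  -- One positive partial sum bounds all later sums below by a fixed positive number, so strictness
  -- survives the limit.
  have hpos : 0 < (1 - r) * ((∑ i ∈ Finset.range (N + 1), c i) * r ^ (N + 1)) :=
    mul_pos (by linarith) (by positivity)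
  refine hpos.trans_le (ge_of_tendsto hv.tendsto_sum_nat
    (eventually_atTop.2 ⟨N + 1, fun n hn => ?_⟩))
  rw [sum_mul_pow_eq]
  have h1 : (∑ i ∈ Finset.range (N + 1), c i) * r ^ (N + 1) ≤
      ∑ j ∈ Finset.range n, (∑ i ∈ Finset.range (j + 1), c i) * r ^ (j + 1) :=
    Finset.single_le_sum (f := fun j => (∑ i ∈ Finset.range (j + 1), c i) * r ^ (j + 1))
      (fun j _ => mul_nonneg (hc _) (by positivity)) (Finset.mem_range.2 (by omega))
  have h2 := mul_le_mul_of_nonneg_left h1 (by linarith : (0 : ℝ) ≤ 1 - r)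
  have h3 := mul_nonneg (hc n) (by positivity : 0 ≤ r ^ (n + 1))
  linarith

theorem upperMechanical_zero_or_one {α : ℝ} (hα : α ∈ Set.Ioo (0 : ℝ) 1) (n : ℕ) :
    0 ≤ upperMechanical α 0 n ∧ upperMechanical α 0 n ≤ 1 := by
  have h0 := hα.1
  have h1 := hα.2
  simp only [upperMechanical, add_zero]
  constructor
  · have : ⌈α * (n : ℝ)⌉ ≤ ⌈α * ((n : ℝ) + 1)⌉ := Int.ceil_mono (by nlinarith)
    linarith
  · have : ⌈α * ((n : ℝ) + 1)⌉ ≤ ⌈α * (n : ℝ) + 1⌉ := Int.ceil_mono (by nlinarith)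
    rw [Int.ceil_add_one] at this
    linarith

theorem upperMechanical_apply_zero {α : ℝ} (hα : α ∈ Set.Ioo (0 : ℝ) 1) :
    upperMechanical α 0 0 = 1 := by
  have h : ⌈α⌉ = 1 := by
    rw [Int.ceil_eq_iff]
    push_cast
    constructor <;> linarith [hα.1, hα.2]
  simp [upperMechanical, h]

theorem cons_one_characteristicWord {α : ℝ} (hα : α ∈ Set.Ioo (0 : ℝ) 1) (hirr : Irrational α) :
    cons 1 (characteristicWord α) = upperMechanical α 0 := by
  funext n
  cases n with
  | zero => rw [cons, upperMechanical_apply_zero hα]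
  | succ n =>
    have key : ∀ m : ℕ, 0 < m → ⌈α * (m : ℝ)⌉ = ⌊α * (m : ℝ)⌋ + 1 := fun m hm =>
      (Int.ceil_eq_floor_add_one_iff_notMem _).2 (by
        rintro ⟨z, hz⟩
        exact (hirr.mul_natCast hm.ne').ne_int z hz.symm)
    have h1 := key (n + 1) (by omega)
    have h2 := key (n + 2) (by omega)
    simp only [cons, characteristicWord, shift, lowerMechanical, upperMechanical, add_zero]
    push_cast at h1 h2 ⊢
    rw [show (n : ℝ) + 1 + 1 = n + 2 by ring, h1, h2]
    ring

theorem summable_upperMechanical {α β : ℝ} (hα : α ∈ Set.Ioo (0 : ℝ) 1) (hβ : 1 < β) (m : ℕ) :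
    Summable fun i => (upperMechanical α 0 (m + i) : ℝ) / β ^ (i + 1) := by
  have hβ0 : 0 < β := by linarith
  refine Summable.of_nonneg_of_le (f := fun i => β⁻¹ ^ (i + 1))
    (fun i => div_nonneg (by exact_mod_cast (upperMechanical_zero_or_one hα _).1) (by positivity))
    (fun i => ?_) ((summable_nat_add_iff 1).2
      (summable_geometric_of_lt_one (by positivity) (inv_lt_one_of_one_lt₀ hβ)))
  rw [inv_pow, ← one_div]
  have : (upperMechanical α 0 (m + i) : ℝ) ≤ 1 := by
    exact_mod_cast (upperMechanical_zero_or_one hα (m + i)).2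
  gcongr

/-- The partial sums of the letter differences between the word and its suffix are differences of
heights: never negative, and positive at least once. -/
theorem tsum_upperMechanical_lt {α β : ℝ} (hα : α ∈ Set.Ioo (0 : ℝ) 1) (hirr : Irrational α)
    (hβ : 1 < β) (h1 : HasSum (fun i => (upperMechanical α 0 i : ℝ) / β ^ (i + 1)) 1) (m : ℕ) :
    ∑' i, (upperMechanical α 0 (m + 1 + i) : ℝ) / β ^ (i + 1) < 1 := by
  have hsum : ∀ n, ∑ i ∈ Finset.range n,
      ((upperMechanical α 0 i : ℝ) - upperMechanical α 0 (m + 1 + i)) =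
      ((height (upperMechanical α 0) 0 n - height (upperMechanical α 0) (m + 1) n : ℤ) : ℝ) := by
    intro n
    simp [height, Finset.sum_sub_distrib]
  obtain ⟨N, hN⟩ := exists_height_upperMechanical_lt hirr (Nat.succ_pos m)
  have hpos := hasSum_mul_pow_pos (r := β⁻¹) (N := N)
    (c := fun i => (upperMechanical α 0 i : ℝ) - upperMechanical α 0 (m + 1 + i))
    (v := 1 - ∑' i, (upperMechanical α 0 (m + 1 + i) : ℝ) / β ^ (i + 1))
    (by positivity) (inv_lt_one_of_one_lt₀ hβ)
    (fun n => by
      rw [hsum]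
      exact_mod_cast sub_nonneg.2 (height_upperMechanical_le α (m + 1) n))
    (by rw [hsum]; exact_mod_cast sub_pos.2 hN)
    ((h1.sub (summable_upperMechanical hα hβ (m + 1)).hasSum).congr_fun fun i => by
      rw [inv_pow]; ring)
  linarith

/-- The intermediate value theorem is applied in `r = 1 / β`. The letter 1 at index 0 and another at
`k + 1` contribute `r + r ^ (k + 2)`, which exceeds 1 for `r` near 1. -/
theorem exists_hasSum_upperMechanical {α : ℝ} (hα : α ∈ Set.Ioo (0 : ℝ) 1)
    (hirr : Irrational α) :
    ∃ β : ℝ, 1 < β ∧ HasSum (fun i => (upperMechanical α 0 i : ℝ) / β ^ (i + 1)) 1 := by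
  obtain ⟨k, hk⟩ : ∃ k, upperMechanical α 0 (k + 1) = 1 := by
    by_contra! h
    refine not_eventuallyPeriodic_upperMechanical hirr ⟨1, 1, one_pos, fun n hn => ?_⟩
    have h0 : ∀ n, upperMechanical α 0 (n + 1) = 0 := fun n => by
      have := upperMechanical_zero_or_one hα (n + 1)
      have := h n
      omega
    obtain ⟨m, rfl⟩ : ∃ m, n = m + 1 := ⟨n - 1, by omega⟩
    rw [h0, h0]
  obtain ⟨r₀, hr₀, hr₀', hr₁⟩ : ∃ r : ℝ, 0 < r ∧ r < 1 ∧ 1 < r + r ^ (k + 2) := by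
    have hcont : Continuous fun r : ℝ => r + r ^ (k + 2) := by fun_prop
    have h1 : ∀ᶠ r in 𝓝[<] (1 : ℝ), 1 < r + r ^ (k + 2) :=
      (hcont.tendsto 1).eventually_const_lt (by norm_num) |>.filter_mono nhdsWithin_le_nhds
    have h2 : ∀ᶠ r in 𝓝[<] (1 : ℝ), r ∈ Set.Ioo (0 : ℝ) 1 := Ioo_mem_nhdsLT one_pos
    obtain ⟨r, h, h'⟩ := (h1.and h2).exists
    exact ⟨r, h'.1, h'.2, h⟩
  have hM : ∀ i, (0 : ℝ) ≤ upperMechanical α 0 i ∧ (upperMechanical α 0 i : ℝ) ≤ 1 := fun i => by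
    exact_mod_cast upperMechanical_zero_or_one hα i
  have hgeo : Summable fun i : ℕ => r₀ ^ (i + 1) :=
    (summable_nat_add_iff 1).2 (summable_geometric_of_lt_one hr₀.le hr₀')
  have hbound : ∀ i : ℕ, ∀ r ∈ Set.Icc 0 r₀,
      ‖(upperMechanical α 0 i : ℝ) * r ^ (i + 1)‖ ≤ r₀ ^ (i + 1) := by
    intro i r hr
    rw [norm_mul, Real.norm_of_nonneg (hM i).1, norm_pow, Real.norm_of_nonneg hr.1]
    exact (mul_le_of_le_one_left (pow_nonneg hr.1 _) (hM i).2).trans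
      (pow_le_pow_left₀ hr.1 hr.2 _)
  have hcont : ContinuousOn (fun r : ℝ => ∑' i, (upperMechanical α 0 i : ℝ) * r ^ (i + 1))
      (Set.Icc 0 r₀) :=
    continuousOn_tsum (fun i => by fun_prop) hgeo hbound
  have hsummable : ∀ r ∈ Set.Icc 0 r₀,
      Summable fun i => (upperMechanical α 0 i : ℝ) * r ^ (i + 1) := fun r hr =>
    Summable.of_norm_bounded hgeo fun i => hbound i r hr
  have hlow : (∑' i, (upperMechanical α 0 i : ℝ) * (0 : ℝ) ^ (i + 1)) ≤ 1 := by simp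
  have hhigh : 1 ≤ ∑' i, (upperMechanical α 0 i : ℝ) * r₀ ^ (i + 1) := by
    have h := (hsummable r₀ ⟨hr₀.le, le_rfl⟩).sum_le_tsum {0, k + 1}
      (fun i _ => mul_nonneg (hM i).1 (by positivity))
    rw [Finset.sum_pair (by omega), hk, upperMechanical_apply_zero hα] at h
    norm_num at h
    linarith
  obtain ⟨r, hr, hr1⟩ := intermediate_value_Icc hr₀.le hcont ⟨hlow, hhigh⟩
  have hrpos : 0 < r := hr.1.lt_of_ne (by rintro rfl; simp at hr1)
  refine ⟨r⁻¹, (one_lt_inv₀ hrpos).2 (hr.2.trans_lt hr₀'), ?_⟩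
  have := (hsummable r hr).hasSum
  simp only at hr1
  rw [hr1] at this
  simpa only [inv_pow, div_inv_eq_mul] using this

/-- The `β`-expansion of `1` for the base determined by the upper mechanical word. -/
theorem betaExpansion_one_eq {α β : ℝ} (hα : α ∈ Set.Ioo (0 : ℝ) 1) (hirr : Irrational α)
    (hβ : 1 < β) (h1 : HasSum (fun i => (upperMechanical α 0 i : ℝ) / β ^ (i + 1)) 1) :
    betaExpansion β 1 = upperMechanical α 0 := by
  have h := betaExpansion_eq hβ
    (y := fun n => ∑' i, (upperMechanical α 0 (n + i) : ℝ) / β ^ (i + 1))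
    (fun n => (summable_upperMechanical hα hβ n).hasSum)
    (fun n => tsum_nonneg fun i => div_nonneg
      (by exact_mod_cast (upperMechanical_zero_or_one hα _).1) (by positivity))
    (fun n => tsum_upperMechanical_lt hα hirr hβ h1 n)
  simpa only [zero_add, h1.tsum_eq] using h

/-- One letter is dropped because the whole word has value 1, outside `[0, 1)`; minimality later
recovers it. -/
theorem orbitClosure_shift_upperMechanical_subset {α β : ℝ} (hα : α ∈ Set.Ioo (0 : ℝ) 1)
    (hirr : Irrational α) (hβ : 1 < β)
    (h1 : HasSum (fun i => (upperMechanical α 0 i : ℝ) / β ^ (i + 1)) 1) :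
    orbitClosure (shift (upperMechanical α 0)) ⊆ betaShift β := by
  apply closure_mono
  rintro _ ⟨n, rfl⟩
  have h := betaExpansion_eq hβ (w := shift^[n] (shift (upperMechanical α 0)))
    (y := fun m => ∑' i, (upperMechanical α 0 (n + m + 1 + i) : ℝ) / β ^ (i + 1))
    (fun m => by
      have := (summable_upperMechanical hα hβ (n + m + 1)).hasSum
      refine this.congr_fun fun i => ?_
      rw [iterate_shift_apply, shift, show n + (m + i) + 1 = n + m + 1 + i by omega])
    (fun n => tsum_nonneg fun i => div_nonneg
      (by exact_mod_cast (upperMechanical_zero_or_one hα _).1) (by positivity))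
    (fun m => tsum_upperMechanical_lt hα hirr hβ h1 (n + (m + 1)))
  exact ⟨_, ⟨tsum_nonneg fun i => div_nonneg
      (by exact_mod_cast (upperMechanical_zero_or_one hα _).1) (by positivity),
    tsum_upperMechanical_lt hα hirr hβ h1 (n + 0)⟩, h⟩

theorem le_of_upperMechanical_mem_betaShift {α β γ : ℝ} (hα : α ∈ Set.Ioo (0 : ℝ) 1)
    (h1 : HasSum (fun i => (upperMechanical α 0 i : ℝ) / β ^ (i + 1)) 1) (hγ : 1 < γ)
    (h : upperMechanical α 0 ∈ betaShift γ) : β ≤ γ := by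
  by_contra! hlt
  have hb := (mem_betaShift_bounds hγ h).2
  have hs := summable_upperMechanical hα hγ 0
  simp only [zero_add] at hs
  have h2 := hasSum_div_pow_lt (fun n => (upperMechanical_zero_or_one hα n).1)
    (by rw [upperMechanical_apply_zero hα]; exact one_pos) (by linarith) hlt hs.hasSum h1
  exact absurd (le_of_tendsto' hs.hasSum.tendsto_sum_nat hb) (not_le.2 h2)

/-! ### The smallest `β`-shift -/

/-- The base determined by the upper mechanical word gives the smallest `β`-shift. -/
theorem IsSturmian.isSmallestBetaShift {s : Word} {α β : ℝ} (hs : IsSturmian s)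
    (hslope : HasSlope s α) (hβ : 1 < β)
    (h1 : HasSum (fun i => (upperMechanical α 0 i : ℝ) / β ^ (i + 1)) 1) :
    IsSmallestBetaShift β (orbitClosure s) := by
  have hα := hs.slope_mem_Ioo hslope
  have hirr := hs.irrational_slope hslope
  have hmem := hs.upperMechanical_mem_orbitClosure hslope
  refine ⟨hβ, ⟨⟨β, hβ, rfl⟩, ?_⟩, ?_⟩
  · rw [← hs.orbitClosure_eq (shift_mem_orbitClosure hmem)
      (not_eventuallyPeriodic_shift (not_eventuallyPeriodic_upperMechanical hirr))]
    exact orbitClosure_shift_upperMechanical_subset hα hirr hβ h1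
  · rintro _ ⟨⟨γ, hγ, rfl⟩, hsub⟩
    exact betaShift_mono hβ (le_of_upperMechanical_mem_betaShift hα h1 hγ (hsub hmem))

end SturmianBeta

theorem mainTheorem3 (s : SturmianBeta.Word) (α : ℝ)
    (hs : SturmianBeta.IsSturmian s) (hα : SturmianBeta.HasSlope s α) :
    (∃ β : ℝ, SturmianBeta.IsSmallestBetaShift β (SturmianBeta.orbitClosure s)) ∧
    ∀ β : ℝ, SturmianBeta.IsSmallestBetaShift β (SturmianBeta.orbitClosure s) →
      SturmianBeta.betaExpansion β 1 =
        SturmianBeta.cons 1 (SturmianBeta.characteristicWord α) ∧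
      SturmianBeta.orbitClosure (SturmianBeta.betaExpansion β 1) =
        SturmianBeta.orbitClosure s ∧
      HasSum (fun n : ℕ => (SturmianBeta.upperMechanical α 0 n : ℝ) / β ^ (n + 1)) 1 ∧
      ∀ x : ℝ, 0 < x →
        HasSum (fun n : ℕ => (SturmianBeta.upperMechanical α 0 n : ℝ) / x ^ (n + 1)) 1 →
        x = β := by
  have hα' := hs.slope_mem_Ioo hα
  have hirr := hs.irrational_slope hα
  obtain ⟨β₀, hβ₀, h1⟩ := SturmianBeta.exists_hasSum_upperMechanical hα' hirr
  have hleast := hs.isSmallestBetaShift hα hβ₀ h1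
  refine ⟨⟨β₀, hleast⟩, fun β hβ => ?_⟩
  have heq : SturmianBeta.betaShift β = SturmianBeta.betaShift β₀ := hβ.2.unique hleast.2
  obtain rfl : β = β₀ := le_antisymm (SturmianBeta.le_of_betaShift_subset hβ₀ heq.subset)
    (SturmianBeta.le_of_betaShift_subset hβ.1 heq.symm.subset)
  have hexp := SturmianBeta.betaExpansion_one_eq hα' hirr hβ₀ h1
  refine ⟨?_, ?_, h1, fun x hx hx1 => ?_⟩
  · rw [hexp, SturmianBeta.cons_one_characteristicWord hα' hirr]
  · rw [hexp]
    exact hs.orbitClosure_eq (hs.upperMechanical_mem_orbitClosure hα)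
      (SturmianBeta.not_eventuallyPeriodic_upperMechanical hirr)
  · have hnn := fun n => (SturmianBeta.upperMechanical_zero_or_one hα' n).1
    have hpos : 0 < SturmianBeta.upperMechanical α 0 0 := by
      rw [SturmianBeta.upperMechanical_apply_zero hα']; exact one_pos
    -- The value decreases strictly on all positive bases, so `x > 1` is not needed.
    rcases lt_trichotomy x β with h | h | h
    · exact absurd (SturmianBeta.hasSum_div_pow_lt hnn hpos hx h hx1 h1) (lt_irrefl _)
    · exact h
    · exact absurd (SturmianBeta.hasSum_div_pow_lt hnn hpos (by linarith) h h1 hx1) (lt_irrefl _)
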